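/- All graphs are finite, simple and undirected. In a drawing of a graph in the plane, vertices are distinct points, every edge is a simple arc joining its end vertices and containing no other vertex, and any two distinct edges cross (rather than touch) at each of their common points that is not a vertex. A drawing is $1$-planar if every edge is crossed at most once; as usual, edges with a common end vertex are required not to cross. For a $1$-planar drawing $D$, let $D^\times$ be the plane graph obtained by turning every crossing into a new vertex of degree four (a false vertex), and let $N_{D^\times}(c)$ be the set of neighbours of $c$ in $D^\times$. A graph is of class $\mathcal C_0$ if it has a $1$-planar drawing $D$ with $N_{D^\times}(c_1)\cap N_{D^\times}(c_2)=\emptyset$ for any two distinct false vertices $c_1,c_2$ of $D^\times$. It is of class $\mathcal C_1$ if it is not of class $\mathcal C_0$ and has a $1$-planar drawing $D$ with $|N_{D^\times}(c_1)\cap N_{D^\times}(c_2)|\le 1$ for any two distinct false vertices $c_1,c_2$ of $D^\times$. The join $G+H$ consists of vertex-disjoint copies of $G$ and $H$ together with all edges between $V(G)$ and $V(H)$; $2P_1$ is the graph with two vertices and no edge, $P_2$ is the path on two vertices, and $\Delta(G)$ is the maximum degree of $G$. Lemma. If $G+2P_1$ or $G+P_2$ is of class $\mathcal C_1$, then $\Delta(G)\le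 4$. Moreover, this bound is tight in both cases: there is a graph $G$ with $\Delta(G)=4$ such that $G+2P_1$ is of class $\mathcal C_1$, and there is a graph $G$ with $\Delta(G)=4$ such that $G+P_2$ is of class $\mathcal C_1$. -/

import Mathlib

namespace OnePlanar

/-- The Euclidean plane. -/
abbrev Plane : Type := EuclideanSpace ℝ (Fin 2)

/-- `A` is a simple arc in the plane with end points `p` and `q`. -/
def IsSimpleArc (A : Set Plane) (p q : Plane) : Prop :=
  ∃ γ : Path p q, Function.Injective γ ∧ Set.range γ = A

/-- The sets `A` and `B` cross (rather than touch) at `p`: in suitable local coordinates of the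
plane around `p`, they are the two coordinate axes and `p` is the origin. -/
def CrossAt (A B : Set Plane) (p : Plane) : Prop :=
  ∃ φ : OpenPartialHomeomorph Plane Plane, p ∈ φ.source ∧ φ p = 0 ∧
    ∀ x ∈ φ.source, (x ∈ A ↔ φ x 1 = 0) ∧ (x ∈ B ↔ φ x 0 = 0)

/-- A drawing of a graph in the plane: vertices are distinct points, edges are simple arcs that
join their end vertices and contain no other vertex, and any two distinct edges cross at each of
their common points that is not a vertex. -/
structure Drawing {V : Type*} (G : SimpleGraph V) where
  point : V → Plane
  arc : G.edgeSet → Set Plane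
  point_injective : Function.Injective point
  arc_isSimpleArc : ∀ (u v : V) (h : G.Adj u v),
    IsSimpleArc (arc ⟨s(u, v), h⟩) (point u) (point v)
  mem_of_point_mem_arc : ∀ (v : V) (e : G.edgeSet), point v ∈ arc e → v ∈ (e : Sym2 V)
  crossAt : ∀ (e f : G.edgeSet) (p : Plane), e ≠ f → p ∈ arc e → p ∈ arc f →
    p ∉ Set.range point → CrossAt (arc e) (arc f) p

/-- In the drawing `D`, the distinct edges `e` and `f` have a crossing at the point `p`. -/
def Drawing.IsCrossing {V : Type*} {G : SimpleGraph V} (D : Drawing G)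
    (e f : G.edgeSet) (p : Plane) : Prop :=
  e ≠ f ∧ p ∈ D.arc e ∧ p ∈ D.arc f ∧ p ∉ Set.range D.point

/-- A 1-planar drawing: every edge is crossed at most once, and (as usual) edges with a common
end vertex do not cross. -/
structure OnePlanarDrawing {V : Type*} (G : SimpleGraph V) extends Drawing G where
  crossed_at_most_once : ∀ (e f f' : G.edgeSet) (p p' : Plane),
    toDrawing.IsCrossing e f p → toDrawing.IsCrossing e f' p' → f = f' ∧ p = p'
  adjacent_not_crossing : ∀ (e f : G.edgeSet) (v : V) (p : Plane),
    v ∈ (e : Sym2 V) → v ∈ (f : Sym2 V) → ¬ toDrawing.IsCrossing e f p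

/-- The false vertices of the associated plane graph: the crossings of the drawing. -/
def OnePlanarDrawing.FalseVertex {V : Type*} {G : SimpleGraph V} (D : OnePlanarDrawing G) :
    Type :=
  {p : Plane // ∃ e f : G.edgeSet, D.IsCrossing e f p}

/-- The associated plane graph of a 1-planar drawing (as an abstract graph), on the true vertices
(left summand) and the false vertices (right summand). An edge without crossings stays an edge
between true vertices; an edge with a crossing `c` is replaced by the two edges that join `c` to
its end vertices. As every edge is crossed at most once, false vertices are never adjacent. -/
def OnePlanarDrawing.associatedGraph {V : Type*} {G : SimpleGraph V} (D : OnePlanarDrawing G) :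
    SimpleGraph (V ⊕ D.FalseVertex) where
  Adj
    | Sum.inl u, Sum.inl v =>
        ∃ e : G.edgeSet, (e : Sym2 V) = s(u, v) ∧ ∀ f p, ¬ D.IsCrossing e f p
    | Sum.inl v, Sum.inr c => ∃ e f : G.edgeSet, D.IsCrossing e f c.1 ∧ v ∈ (e : Sym2 V)
    | Sum.inr c, Sum.inl v => ∃ e f : G.edgeSet, D.IsCrossing e f c.1 ∧ v ∈ (e : Sym2 V)
    | Sum.inr _, Sum.inr _ => False
  symm := ⟨by
    rintro (u | c) (v | d) h
    · obtain ⟨e, he, hf⟩ := h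
      exact ⟨e, he.trans Sym2.eq_swap, hf⟩
    · exact h
    · exact h
    · exact h⟩
  loopless := ⟨by
    rintro (u | c) h
    · obtain ⟨e, he, -⟩ := h
      have h' := e.2
      rw [he] at h'
      exact G.loopless.irrefl u h'
    · exact h⟩

/-- The graph `G` has a 1-planar drawing in which any two (distinct) false vertices of the
associated plane graph have at most `i` common neighbours. -/
def HasDrawingWithCommonNeighborsLE {V : Type*} (G : SimpleGraph V) (i : ℕ) : Prop :=
  ∃ D : OnePlanarDrawing G, ∀ c₁ c₂ : D.FalseVertex, c₁ ≠ c₂ →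
    (D.associatedGraph.neighborSet (Sum.inr c₁) ∩
      D.associatedGraph.neighborSet (Sum.inr c₂)).encard ≤ i

/-- The graph `G` is (1-planar and) of class `𝓒₀`. -/
def IsOfClassC₀ {V : Type*} (G : SimpleGraph V) : Prop :=
  HasDrawingWithCommonNeighborsLE G 0

/-- The graph `G` is (1-planar and) of class `𝓒₁`. -/
def IsOfClassC₁ {V : Type*} (G : SimpleGraph V) : Prop :=
  ¬ IsOfClassC₀ G ∧ HasDrawingWithCommonNeighborsLE G 1

/-- The join of two graphs: disjoint copies of `G` and `H` together with all edges between
them. -/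
def join {V W : Type*} (G : SimpleGraph V) (H : SimpleGraph W) : SimpleGraph (V ⊕ W) :=
  (G ⊕g H) ⊔ completeBipartiteGraph V W

/-- `2P₁`, the graph with two vertices and no edge. -/
abbrev twoP₁ : SimpleGraph (Fin 2) := ⊥

/-- `P₂`, the path on two vertices. -/
abbrev P₂ : SimpleGraph (Fin 2) := SimpleGraph.pathGraph 2

end OnePlanar

/-! A vertex of degree `m` in `G`, together with the two added vertices, spans a `K₃ₘ` in the join
with its neighbours. Call two of the `m` vertices in conflict if edges of the `K₃ₘ` at them cross.
Any two crossings share one of the three vertices on the small side, as two pairs in a triple always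
meet. Hence under the `𝓒₁` bound conflicts form a matching (`Conflict.unique`), and under the `𝓒₀`
bound there is at most one (`Conflict.eq_or_eq`). For `m = 5` a matching leaves three conflict-free
vertices, contradicting the nonplanarity of `K₃₃`; for `m = 4`, omitting an end of the conflict does
the same.

Nonplanarity is proved for arbitrary continuous curves: logarithms of differences of points on
independent edges give integer equations that are inconsistent modulo 4.

Tightness comes from the star with four leaves. The case `m = 4` excludes `𝓒₀`, and one explicit
straight-line drawing, checked by integer orientations, serves both joins. -/

namespace OnePlanar
open Complex

/-! ### Nonplanarity of `K₃₃` by continuous logarithms -/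

/-- Two continuous logarithms of a function on the real line have the same increments. -/
theorem log_increment_unique {F F' : ℝ → ℂ} (hF : Continuous F) (hF' : Continuous F')
    (h : ∀ s, exp (F s) = exp (F' s)) : F 1 - F 0 = F' 1 - F' 0 := by
  have hexp : IsLocalHomeomorph fun z : ℂ ↦ (⟨_, z.exp_ne_zero⟩ : {z : ℂ // z ≠ 0}) :=
    isCoveringMap_exp.isLocalHomeomorph
  obtain ⟨n, hn⟩ := exp_eq_exp_iff_exists_int.1 (h 0)
  have hc : Continuous fun s ↦ F' s + n * (2 * Real.pi * I) := by fun_prop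
  have key := isCoveringMap_exp.eq_of_comp_eq hF hc (by
    funext s
    apply Subtype.ext
    simp only [Function.comp_apply]
    rw [h s]
    exact (exp_eq_exp_iff_exists_int.2 ⟨-n, by push_cast; ring⟩)) 0 hn
  have h1 := congrFun key 1
  have h0 := congrFun key 0
  beta_reduce at h1 h0
  rw [h1, h0]; ring

/-- A real topological vector space is contractible, so a nowhere-zero function lifts through the
covering `exp`. -/
theorem exists_continuous_log {X : Type*} [AddCommGroup X] [Module ℝ X] [TopologicalSpace X]
    [ContinuousAdd X] [ContinuousSMul ℝ X] [LocallyPathConnectedSpace X] {f : X → ℂ}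
    (hf : Continuous f) (h0 : ∀ x, f x ≠ 0) :
    ∃ F : X → ℂ, Continuous F ∧ ∀ x, exp (F x) = f x := by
  obtain ⟨F, ⟨-, hF⟩, -⟩ := isCoveringMapOn_exp.existsUnique_continuousMap_lifts
    ⟨f, hf⟩ (a₀ := 0) (exp_log (h0 0)) h0
  exact ⟨F, F.continuous, congrFun hF⟩

/-- For disjoint curves `γ` and `δ`, the increments of the logarithm of `γ s - δ t` along the
four sides of the parameter square add up to zero. -/
theorem log_increment_square {γ δ : ℝ → ℂ} (hγ : Continuous γ) (hδ : Continuous δ)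
    (h : ∀ s t, γ s ≠ δ t) {F₀ F₁ E₀ E₁ : ℝ → ℂ} (hF₀ : Continuous F₀) (hF₁ : Continuous F₁)
    (hE₀ : Continuous E₀) (hE₁ : Continuous E₁)
    (hF₀' : ∀ s, exp (F₀ s) = γ s - δ 0) (hF₁' : ∀ s, exp (F₁ s) = γ s - δ 1)
    (hE₀' : ∀ t, exp (E₀ t) = δ t - γ 0) (hE₁' : ∀ t, exp (E₁ t) = δ t - γ 1) :
    (F₀ 1 - F₀ 0) + (E₁ 1 - E₁ 0) = (F₁ 1 - F₁ 0) + (E₀ 1 - E₀ 0) := by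
  obtain ⟨M, hM, hM'⟩ := exists_continuous_log (X := ℝ × ℝ) (f := fun x ↦ γ x.1 - δ x.2)
    (by fun_prop) (fun x ↦ sub_ne_zero.2 (h _ _))
  have a := log_increment_unique hF₀ (F' := fun s ↦ M (s, 0)) (by fun_prop)
    (fun s ↦ by rw [hF₀', hM'])
  have b := log_increment_unique hF₁ (F' := fun s ↦ M (s, 1)) (by fun_prop)
    (fun s ↦ by rw [hF₁', hM'])
  -- `δ t - γ 0` is the negative of the function with logarithm `M`, hence the shift by `π * I`.
  have c := log_increment_unique hE₀ (F' := fun t ↦ M (0, t) + Real.pi * I) (by fun_prop)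
    (fun s ↦ by rw [hE₀', exp_add, hM', exp_pi_mul_I]; ring)
  have d := log_increment_unique hE₁ (F' := fun t ↦ M (1, t) + Real.pi * I) (by fun_prop)
    (fun s ↦ by rw [hE₁', exp_add, hM', exp_pi_mul_I]; ring)
  beta_reduce at a b c d
  rw [a, b, c, d]; ring

/-- A choice of a logarithm of `P i - P j` such that exchanging `i` and `j` changes it by
`± π * I`. -/
noncomputable def pairLog (P : Fin 3 → ℂ) (i j : Fin 3) : ℂ :=
  if i < j then log (P i - P j) else log (P j - P i) + Real.pi * I

/-- The sign of a pair of distinct indices. -/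
def pairSign (i j : Fin 3) : ℤ := if i < j then 1 else -1

theorem exp_pairLog {P : Fin 3 → ℂ} (hP : Function.Injective P) {i j : Fin 3} (h : i ≠ j) :
    exp (pairLog P i j) = P i - P j := by
  unfold pairLog
  split_ifs
  · exact exp_log (sub_ne_zero.2 (hP.ne h))
  · rw [exp_add, exp_log (sub_ne_zero.2 (hP.ne h.symm)), exp_pi_mul_I]; ring

theorem pairLog_sub_pairLog (P : Fin 3 → ℂ) {i j : Fin 3} (h : i ≠ j) :
    pairLog P j i - pairLog P i j = pairSign i j * (Real.pi * I) := by
  unfold pairLog pairSign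
  rcases lt_or_gt_of_ne h with h | h
  · simp [h, h.not_gt]
  · simp [h, h.not_gt]

/-- The complete bipartite graph `K₃₃` cannot be drawn in the plane such that independent edges
are disjoint. -/
theorem exists_independent_curves_meet (A B : Fin 3 → ℂ) (γ : Fin 3 → Fin 3 → ℝ → ℂ)
    (hγ : ∀ i j, Continuous (γ i j)) (h0 : ∀ i j, γ i j 0 = A i) (h1 : ∀ i j, γ i j 1 = B j) :
    ∃ i i' j j', i ≠ i' ∧ j ≠ j' ∧ ∃ s t, γ i j s = γ i' j' t := by
  by_contra! hd
  have other : ∀ i : Fin 3, ∃ j, i ≠ j := by decide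
  have hA : ∀ i j i', i ≠ i' → ∀ s, γ i j s ≠ A i' := fun i j i' h s ↦ by
    obtain ⟨j', hj⟩ := other j
    rw [← h0 i' j']; exact hd _ _ _ _ h hj _ _
  have hB : ∀ i j j', j ≠ j' → ∀ s, γ i j s ≠ B j' := fun i j j' h s ↦ by
    obtain ⟨i', hi⟩ := other i
    rw [← h1 i' j']; exact hd _ _ _ _ hi h _ _
  have hAB : ∀ i j, A i ≠ B j := fun i j ↦ by
    obtain ⟨j', hj⟩ := other j
    rw [← h0 i j']; exact hB _ _ _ hj.symm _
  have iA : Function.Injective A := fun i i' h ↦ by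
    by_contra hne
    exact hA i 0 i' hne 0 (by rw [h0, h])
  have iB : Function.Injective B := fun j j' h ↦ by
    by_contra hne
    exact hB 0 j j' hne 1 (by rw [h1, h])
  have exists_n : ∀ {z w : ℂ} (F : ℝ → ℂ), exp (F 1) = exp z → exp (F 0) = exp w →
      ∃ n : ℤ, F 1 - F 0 = z - w + n * (2 * Real.pi * I) := fun F hz hw ↦ by
    obtain ⟨n, hn⟩ := exp_eq_exp_iff_exists_int.1 hz
    obtain ⟨m, hm⟩ := exp_eq_exp_iff_exists_int.1 hw
    exact ⟨n - m, by rw [hn, hm]; push_cast; ring⟩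
  -- Relative to fixed logarithms of the end values, each increment is determined up to an integer
  -- multiple of `2πi`. The values for `i = i'` are dummies that make the later `choose` total.
  have eA : ∀ i j i', ∃ F : ℝ → ℂ, ∃ n : ℤ, i ≠ i' → Continuous F ∧
      (∀ s, exp (F s) = γ i j s - A i') ∧
      F 1 - F 0 = log (A i' - B j) + Real.pi * I - pairLog A i i' + n * (2 * Real.pi * I) := by
    intro i j i'
    by_cases h : i = i'
    · exact ⟨0, 0, fun h' ↦ absurd h h'⟩
    obtain ⟨F, hF, hF'⟩ := exists_continuous_log (f := fun s ↦ γ i j s - A i')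
      ((hγ i j).sub continuous_const) (fun s ↦ sub_ne_zero.2 (hA i j i' h s))
    obtain ⟨n, hn⟩ := exists_n (z := log (A i' - B j) + Real.pi * I) (w := pairLog A i i') F
      (by rw [hF', h1, exp_add, exp_log (sub_ne_zero.2 (hAB _ _)), exp_pi_mul_I]; ring)
      (by rw [hF', h0, exp_pairLog iA h])
    exact ⟨F, n, fun _ ↦ ⟨hF, hF', hn⟩⟩
  have eB : ∀ i j j', ∃ F : ℝ → ℂ, ∃ n : ℤ, j ≠ j' → Continuous F ∧
      (∀ s, exp (F s) = γ i j s - B j') ∧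
      F 1 - F 0 = pairLog B j j' - log (A i - B j') + n * (2 * Real.pi * I) := by
    intro i j j'
    by_cases h : j = j'
    · exact ⟨0, 0, fun h' ↦ absurd h h'⟩
    obtain ⟨F, hF, hF'⟩ := exists_continuous_log (f := fun s ↦ γ i j s - B j')
      ((hγ i j).sub continuous_const) (fun s ↦ sub_ne_zero.2 (hB i j j' h s))
    obtain ⟨n, hn⟩ := exists_n (z := pairLog B j j') (w := log (A i - B j')) F
      (by rw [hF', h1, exp_pairLog iB h])
      (by rw [hF', h0, exp_log (sub_ne_zero.2 (hAB _ _))])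
    exact ⟨F, n, fun _ ↦ ⟨hF, hF', hn⟩⟩
  choose F n hF using eA
  choose E m hE using eB
  -- In the square identity the logarithms of `A - B` cancel, and the pair logarithms leave only
  -- their signs.
  have key : ∀ i i' j j', i ≠ i' → j ≠ j' → pairSign i i' + pairSign j j' +
      2 * (n i j i' + m i' j' j - m i j j' - n i' j' i) = 0 := by
    intro i i' j j' hi hj
    obtain ⟨a₁, a₂, a₃⟩ := hF i j i' hi
    obtain ⟨b₁, b₂, b₃⟩ := hF i' j' i hi.symm
    obtain ⟨c₁, c₂, c₃⟩ := hE i j j' hj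
    obtain ⟨d₁, d₂, d₃⟩ := hE i' j' j hj.symm
    have sq := log_increment_square (hγ i j) (hγ i' j') (hd i i' j j' hi hj) a₁ c₁ b₁ d₁
      (fun s ↦ by rw [a₂, h0]) (fun s ↦ by rw [c₂, h1]) (fun s ↦ by rw [b₂, h0])
      (fun s ↦ by rw [d₂, h1])
    rw [a₃, b₃, c₃, d₃] at sq
    have pA := pairLog_sub_pairLog A hi
    have pB := pairLog_sub_pairLog B hj
    have hpi : (Real.pi * I : ℂ) ≠ 0 := mul_ne_zero (by exact_mod_cast Real.pi_ne_zero) I_ne_zero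
    have : ((pairSign i i' + pairSign j j' +
        2 * (n i j i' + m i' j' j - m i j j' - n i' j' i) : ℤ) : ℂ) * (Real.pi * I) = 0 := by
      push_cast
      linear_combination sq - pA - pB
    exact_mod_cast (mul_eq_zero.1 this).resolve_right hpi
  have e01 := fun j j' ↦ key 0 1 j j' (by decide)
  have e02 := fun j j' ↦ key 0 2 j j' (by decide)
  have e12 := fun j j' ↦ key 1 2 j j' (by decide)
  have s1 : pairSign 0 1 = 1 := rfl
  have s2 : pairSign 0 2 = 1 := rfl
  have s3 : pairSign 1 2 = 1 := rfl
  have s4 : pairSign 1 0 = -1 := rfl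
  have s5 : pairSign 2 0 = -1 := rfl
  have s6 : pairSign 2 1 = -1 := rfl
  have a1 := e01 0 1 (by decide)
  have a2 := e01 0 2 (by decide)
  have a3 := e01 1 2 (by decide)
  have a4 := e01 1 0 (by decide)
  have a5 := e01 2 0 (by decide)
  have a6 := e01 2 1 (by decide)
  have b1 := e02 0 1 (by decide)
  have b2 := e02 0 2 (by decide)
  have b3 := e02 1 2 (by decide)
  have b4 := e02 1 0 (by decide)
  have b5 := e02 2 0 (by decide)
  have b6 := e02 2 1 (by decide)
  have c1 := e12 0 1 (by decide)
  have c2 := e12 0 2 (by decide)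
  have c3 := e12 1 2 (by decide)
  have c4 := e12 1 0 (by decide)
  have c5 := e12 2 0 (by decide)
  have c6 := e12 2 1 (by decide)
  -- Adding all 18 equations, each `n` and each `m` occurs twice up to sign, so with the factor 2
  -- they contribute a multiple of 4. The `j`-signs cancel and the `i`-signs add to 18, which is 2
  -- modulo 4.
  omega

end OnePlanar

namespace OnePlanar

/-! ### Crossings in drawings of complete bipartite graphs -/

variable {V : Type*} {K : SimpleGraph V}

/-- In any drawing that contains `K₃₃`, two independent edges of `K₃₃` cross. -/
theorem Drawing.exists_isCrossing (D : Drawing K) {α β : Fin 3 → V} (hα : Function.Injective α)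
    (hβ : Function.Injective β) (h : ∀ i j, K.Adj (α i) (β j)) :
    ∃ i i' j j', i ≠ i' ∧ j ≠ j' ∧
      ∃ p, D.IsCrossing ⟨s(α i, β j), h i j⟩ ⟨s(α i', β j'), h i' j'⟩ p := by
  choose γ _ hγ using fun i j ↦ D.arc_isSimpleArc _ _ (h i j)
  let c : Plane ≃ₗᵢ[ℝ] ℂ := Complex.orthonormalBasisOneI.repr.symm
  obtain ⟨i, i', j, j', hi, hj, s, t, hst⟩ := exists_independent_curves_meet
    (fun i ↦ c (D.point (α i))) (fun j ↦ c (D.point (β j)))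
    (fun i j s ↦ c ((γ i j).extend s)) (fun i j ↦ c.continuous.comp (γ i j).continuous_extend)
    (fun i j ↦ by simp) (fun i j ↦ by simp)
  have hmem : ∀ i j s, (γ i j).extend s ∈ D.arc ⟨s(α i, β j), h i j⟩ := fun i j s ↦ by
    rw [← hγ i j, ← (γ i j).extend_range]
    exact ⟨s, rfl⟩
  have hst' := c.injective hst
  have hαβ : ∀ i j, α i ≠ β j := fun i j ↦ (h i j).ne
  refine ⟨i, i', j, j', hi, hj, (γ i j).extend s, ?_, hmem _ _ _, hst' ▸ hmem _ _ _, ?_⟩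
  · intro he
    have := congrArg Subtype.val he
    simp [hα.ne hi, hαβ] at this
  · rintro ⟨v, hv⟩
    have hv₁ := D.mem_of_point_mem_arc v _ (hv ▸ hmem i j s)
    have hv₂ := D.mem_of_point_mem_arc v _ (hv ▸ hst' ▸ hmem i' j' t)
    simp only [Sym2.mem_iff] at hv₁ hv₂
    rcases hv₁ with rfl | rfl <;> rcases hv₂ with h' | h'
    exacts [hi (hα h'), hαβ _ _ h', hαβ _ _ h'.symm, hj (hβ h')]

theorem Drawing.IsCrossing.symm {D : Drawing K} {e f : K.edgeSet} {p : Plane}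
    (h : D.IsCrossing e f p) : D.IsCrossing f e p :=
  ⟨h.1.symm, h.2.2.1, h.2.1, h.2.2.2⟩

theorem OnePlanarDrawing.not_isCrossing_join_same (D : OnePlanarDrawing K) {a a' b : V}
    (h : K.Adj a b) (h' : K.Adj a' b) (p : Plane) :
    ¬ D.IsCrossing ⟨s(a, b), h⟩ ⟨s(a', b), h'⟩ p :=
  D.adjacent_not_crossing _ _ b p (by simp) (by simp)

/-- Among the edges from a fixed triple of vertices to a set of vertices `β j`, edges at `β j`
and at `β j'` cross. -/
def Conflict (D : OnePlanarDrawing K) {m : ℕ} {α : Fin 3 → V} {β : Fin m → V}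
    (h : ∀ i j, K.Adj (α i) (β j)) (j j' : Fin m) : Prop :=
  ∃ i i' p, D.IsCrossing ⟨s(α i, β j), h i j⟩ ⟨s(α i', β j'), h i' j'⟩ p

section

variable {D : OnePlanarDrawing K} {m : ℕ} {α : Fin 3 → V} {β : Fin m → V}
  {h : ∀ i j, K.Adj (α i) (β j)}

theorem Conflict.symm {j j' : Fin m} : Conflict D h j j' → Conflict D h j' j := by
  rintro ⟨i, i', p, hp⟩
  exact ⟨i', i, p, hp.symm⟩

theorem Conflict.ne {j j' : Fin m} : Conflict D h j j' → j ≠ j' := by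
  rintro ⟨i, i', p, hp⟩ rfl
  exact D.not_isCrossing_join_same _ _ _ hp

/-- Three pairwise conflict-free vertices are impossible, since `K₃₃` is not planar. -/
theorem exists_conflict (hα : Function.Injective α) (hβ : Function.Injective β)
    {g : Fin 3 → Fin m} (hg : Function.Injective g) : ∃ j j', Conflict D h (g j) (g j') := by
  obtain ⟨i, i', j, j', -, -, p, hp⟩ := D.exists_isCrossing hα (hβ.comp hg) (fun i j ↦ h i (g j))
  exact ⟨j, j', i, i', p, hp⟩

/-- The end vertices of crossing edges are neighbours of the false vertex. -/
theorem mem_neighborSet_of_isCrossing {e f : K.edgeSet} {p : Plane} (hp : D.IsCrossing e f p)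
    {v : V} (hv : v ∈ (e : Sym2 V)) :
    Sum.inl v ∈ D.associatedGraph.neighborSet (Sum.inr ⟨p, e, f, hp⟩) :=
  ⟨e, f, hp, hv⟩

/-- Crossings of different points share one of the three vertices `α i`. -/
theorem exists_mem_common_of_isCrossing {i i' l l' : Fin 3} {j j' k k' : Fin m} {p q : Plane}
    (hp : D.IsCrossing ⟨s(α i, β j), h i j⟩ ⟨s(α i', β j'), h i' j'⟩ p)
    (hq : D.IsCrossing ⟨s(α l, β k), h l k⟩ ⟨s(α l', β k'), h l' k'⟩ q) :
    ∃ r, Sum.inl (α r) ∈ D.associatedGraph.neighborSet (Sum.inr ⟨p, _, _, hp⟩) ∩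
      D.associatedGraph.neighborSet (Sum.inr ⟨q, _, _, hq⟩) := by
  have hi : i ≠ i' := by
    rintro rfl
    exact D.adjacent_not_crossing _ _ (α i) p (by simp) (by simp) hp
  have hl : l ≠ l' := by
    rintro rfl
    exact D.adjacent_not_crossing _ _ (α l) q (by simp) (by simp) hq
  have key : ∀ i i' l l' : Fin 3, i ≠ i' → l ≠ l' → ∃ r, (r = i ∨ r = i') ∧ (r = l ∨ r = l') := by
    decide
  obtain ⟨r, hr, hr'⟩ := key i i' l l' hi hl
  refine ⟨r, ?_, ?_⟩
  · rcases hr with rfl | rfl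
    · exact mem_neighborSet_of_isCrossing hp (by simp)
    · exact mem_neighborSet_of_isCrossing hp.symm (by simp)
  · rcases hr' with rfl | rfl
    · exact mem_neighborSet_of_isCrossing hq (by simp)
    · exact mem_neighborSet_of_isCrossing hq.symm (by simp)

/-- If false vertices have at most one common neighbour, conflicts form a matching. -/
theorem Conflict.unique
    (hD : ∀ c₁ c₂ : D.FalseVertex, c₁ ≠ c₂ →
      (D.associatedGraph.neighborSet (Sum.inr c₁) ∩
        D.associatedGraph.neighborSet (Sum.inr c₂)).encard ≤ 1) (hβ : Function.Injective β)
    {j k k' : Fin m} : Conflict D h j k → Conflict D h j k' → k = k' := by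
  rintro ⟨i, i', p, hp⟩ ⟨l, l', q, hq⟩
  by_cases hpq : p = q
  · subst hpq
    by_cases he : (⟨s(α i, β j), h i j⟩ : K.edgeSet) = ⟨s(α l, β j), h l j⟩
    -- At a common point the two edges at `β j` coincide, since adjacent edges do not cross; an edge
    -- is crossed only once.
    · rw [← he] at hq
      have := congrArg Subtype.val (D.crossed_at_most_once _ _ _ _ _ hp hq).1
      simp only [Sym2.eq_iff] at this
      rcases this with h' | h'
      · exact hβ h'.2
      · exact absurd h'.1 (h i' k').ne
    · exact absurd ⟨he, hp.2.1, hq.2.1, hp.2.2.2⟩ (D.not_isCrossing_join_same (h i j) (h l j) p)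
  · exfalso
    obtain ⟨r, hr⟩ := exists_mem_common_of_isCrossing hp hq
    -- Distinct crossings would share both `β j` and some `α r`.
    have hj : Sum.inl (β j) ∈ D.associatedGraph.neighborSet (Sum.inr ⟨p, _, _, hp⟩) ∩
        D.associatedGraph.neighborSet (Sum.inr ⟨q, _, _, hq⟩) :=
      ⟨mem_neighborSet_of_isCrossing hp (by simp), mem_neighborSet_of_isCrossing hq (by simp)⟩
    have := Set.encard_le_one_iff.1 (hD _ _ fun h' ↦ hpq (congrArg Subtype.val h')) _ _ hr hj
    exact (h r j).ne (Sum.inl_injective this)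

/-- If false vertices have no common neighbours, there is at most one conflict. -/
theorem Conflict.eq_or_eq
    (hD : ∀ c₁ c₂ : D.FalseVertex, c₁ ≠ c₂ →
      (D.associatedGraph.neighborSet (Sum.inr c₁) ∩
        D.associatedGraph.neighborSet (Sum.inr c₂)).encard ≤ 0) (hβ : Function.Injective β)
    {j j' k k' : Fin m} :
    Conflict D h j j' → Conflict D h k k' → j = k ∨ j = k' := by
  rintro ⟨i, i', p, hp⟩ ⟨l, l', q, hq⟩
  by_cases hpq : p = q
  · subst hpq
    by_cases he : (⟨s(α i, β j), h i j⟩ : K.edgeSet) = ⟨s(α l, β k), h l k⟩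
    · have := congrArg Subtype.val he
      simp only [Sym2.eq_iff] at this
      rcases this with h' | h'
      · exact .inl (hβ h'.2)
      · exact absurd h'.1 (h i k).ne
    · have hc : D.IsCrossing ⟨s(α l, β k), h l k⟩ ⟨s(α i, β j), h i j⟩ p :=
        ⟨Ne.symm he, hq.2.1, hp.2.1, hp.2.2.2⟩
      have := congrArg Subtype.val (D.crossed_at_most_once _ _ _ _ _ hc hq).1
      simp only [Sym2.eq_iff] at this
      rcases this with h' | h'
      · exact .inr (hβ h'.2)
      · exact absurd h'.1 (h i k').ne
  · exfalso
    obtain ⟨r, hr⟩ := exists_mem_common_of_isCrossing hp hq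
    have hne : (⟨p, _, _, hp⟩ : D.FalseVertex) ≠ ⟨q, _, _, hq⟩ :=
      fun h' ↦ hpq (congrArg Subtype.val h')
    rw [Set.encard_eq_zero.1 (nonpos_iff_eq_zero.1 (hD _ _ hne))] at hr
    exact hr

end

/-- In a symmetric relation on five elements in which every element is related to at most one
element, three elements are pairwise unrelated. -/
theorem exists_unrelated_triple {R : Fin 5 → Fin 5 → Prop} (symm : ∀ {a b}, R a b → R b a)
    (irrefl : ∀ {a b}, R a b → a ≠ b) (unique : ∀ {a b c}, R a b → R a c → b = c) :
    ∃ g : Fin 3 → Fin 5, Function.Injective g ∧ ∀ i j, ¬ R (g i) (g j) := by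
  suffices ∃ a b c, a ≠ b ∧ a ≠ c ∧ b ≠ c ∧ ¬ R a b ∧ ¬ R a c ∧ ¬ R b c by
    obtain ⟨a, b, c, hab, hac, hbc, rab, rac, rbc⟩ := this
    refine ⟨![a, b, c], ?_, ?_⟩
    · intro i j
      fin_cases i <;> fin_cases j <;> simp [hab, hac, hbc, hab.symm, hac.symm, hbc.symm]
    · intro i j hij
      have := irrefl hij
      fin_cases i <;> fin_cases j <;> simp at hij this <;>
        first
          | exact rab hij
          | exact rac hij
          | exact rbc hij
          | exact rab (symm hij)
          | exact rac (symm hij)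
          | exact rbc (symm hij)
  by_contra! H
  have pick : ∀ x : Fin 5, ∃ a b c : Fin 5, a ≠ b ∧ a ≠ c ∧ b ≠ c ∧
      0 ≠ a ∧ 0 ≠ b ∧ 0 ≠ c ∧ x ≠ a ∧ x ≠ b ∧ x ≠ c := by decide
  -- `x` is the only possible partner of `0`; if there is none, any value will do. Three elements
  -- avoiding `0` and `x` are unrelated to `0`, so they would be pairwise related, against
  -- uniqueness.
  obtain ⟨x, hx⟩ : ∃ x, ∀ y, R 0 y → x = y := by
    by_cases h : ∃ x, R 0 x
    · exact ⟨h.choose, fun y hy ↦ unique h.choose_spec hy⟩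
    · exact ⟨0, fun y hy ↦ absurd ⟨y, hy⟩ h⟩
  obtain ⟨a, b, c, hab, hac, hbc, ha, hb, hc, xa, xb, xc⟩ := pick x
  have rab := H 0 a b ha hb hab (fun h ↦ xa (hx _ h)) (fun h ↦ xb (hx _ h))
  have rac := H 0 a c ha hc hac (fun h ↦ xa (hx _ h)) (fun h ↦ xc (hx _ h))
  exact hbc (unique rab rac)

/-- In a drawing with at most one common neighbour, there is no `K₃₅`. -/
theorem not_hasDrawing_one {α : Fin 3 → V} {β : Fin 5 → V} (hα : Function.Injective α)
    (hβ : Function.Injective β) (h : ∀ i j, K.Adj (α i) (β j)) :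
    ¬ HasDrawingWithCommonNeighborsLE K 1 := by
  rintro ⟨D, hD⟩
  obtain ⟨g, hg, hg'⟩ := exists_unrelated_triple (R := Conflict D h) Conflict.symm Conflict.ne
    (Conflict.unique hD hβ)
  obtain ⟨j, j', hj⟩ := exists_conflict (D := D) (h := h) hα hβ hg
  exact hg' j j' hj

/-- In a drawing without common neighbours, there is no `K₃₄`. -/
theorem not_hasDrawing_zero {α : Fin 3 → V} {β : Fin 4 → V} (hα : Function.Injective α)
    (hβ : Function.Injective β) (h : ∀ i j, K.Adj (α i) (β j)) :
    ¬ HasDrawingWithCommonNeighborsLE K 0 := by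
  rintro ⟨D, hD⟩
  obtain ⟨j, j', hj⟩ := exists_conflict (D := D) (h := h) hα hβ (Fin.castSucc_injective 3)
  -- The second triple omits one end of the first conflict, so its conflict is a different one.
  obtain ⟨k, k', hk⟩ := exists_conflict (D := D) (h := h) hα hβ
    (Fin.succAbove_right_injective (p := j.castSucc))
  rcases Conflict.eq_or_eq hD hβ hj hk with h' | h'
  exacts [Fin.succAbove_ne _ _ h'.symm, Fin.succAbove_ne _ _ h'.symm]

/-! ### Degree bounds for joins -/

theorem join_adj_inl_inl {W : Type*} {G : SimpleGraph V} {H : SimpleGraph W} {u v : V} :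
    (join G H).Adj (Sum.inl u) (Sum.inl v) ↔ G.Adj u v := by
  simp [join]

theorem join_adj_inl_inr {W : Type*} (G : SimpleGraph V) (H : SimpleGraph W) (u : V) (w : W) :
    (join G H).Adj (Sum.inl u) (Sum.inr w) := by
  simp [join]

/-- A vertex `v` of degree at least `m` gives a `K₃ₘ` in the join with a graph on two
vertices. -/
theorem exists_completeBipartite_of_le_degree [Fintype V] {G : SimpleGraph V}
    [DecidableRel G.Adj] (H : SimpleGraph (Fin 2)) {v : V} {m : ℕ} (hm : m ≤ G.degree v) :
    ∃ (α : Fin 3 → V ⊕ Fin 2) (β : Fin m → V ⊕ Fin 2), Function.Injective α ∧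
      Function.Injective β ∧ ∀ i j, (join G H).Adj (α i) (β j) := by
  have hcard : Fintype.card (Fin m) ≤ Fintype.card (G.neighborSet v) := by
    rwa [Fintype.card_fin, G.card_neighborSet_eq_degree]
  obtain ⟨u⟩ := Function.Embedding.nonempty_of_card_le hcard
  refine ⟨![Sum.inr 0, Sum.inr 1, Sum.inl v], fun j ↦ Sum.inl (u j), ?_,
    fun j j' h ↦ u.injective (Subtype.ext (Sum.inl_injective h)), ?_⟩
  · intro i j
    fin_cases i <;> fin_cases j <;> simp
  · intro i j
    fin_cases i
    · exact (join_adj_inl_inr G H _ _).symm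
    · exact (join_adj_inl_inr G H _ _).symm
    · exact join_adj_inl_inl.2 (u j).2

theorem maxDegree_le_four [Fintype V] (G : SimpleGraph V) [DecidableRel G.Adj]
    (H : SimpleGraph (Fin 2)) (hG : HasDrawingWithCommonNeighborsLE (join G H) 1) :
    G.maxDegree ≤ 4 := by
  refine G.maxDegree_le_of_forall_degree_le 4 fun v ↦ ?_
  by_contra! hv
  obtain ⟨α, β, hα, hβ, h⟩ := exists_completeBipartite_of_le_degree H (m := 5) hv
  exact not_hasDrawing_one hα hβ h hG

theorem not_isOfClassC₀_join [Fintype V] {G : SimpleGraph V} [DecidableRel G.Adj]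
    (H : SimpleGraph (Fin 2)) {v : V} (hv : 4 ≤ G.degree v) : ¬ IsOfClassC₀ (join G H) := by
  obtain ⟨α, β, hα, hβ, h⟩ := exists_completeBipartite_of_le_degree H hv
  exact not_hasDrawing_zero hα hβ h

end OnePlanar

namespace OnePlanar

/-! ### Crossing segments and orientations -/

/-- The determinant of two plane vectors. -/
def wedge (v w : Plane) : ℝ := v 0 * w 1 - v 1 * w 0

/-- Affine coordinates with origin `p` and basis vectors `v` and `w`. -/
noncomputable def frame (p v w : Plane) (h : wedge v w ≠ 0) : Plane ≃ₜ Plane where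
  toFun x := !₂[wedge (x - p) w / wedge v w, wedge v (x - p) / wedge v w]
  invFun y := p + y 0 • v + y 1 • w
  left_inv x := by
    obtain ⟨D, hD⟩ : ∃ D, D = wedge v w := ⟨_, rfl⟩
    rw [← hD] at h ⊢
    ext i
    fin_cases i <;> simp [wedge] <;> field_simp <;> rw [hD, wedge] <;> ring
  right_inv y := by
    obtain ⟨D, hD⟩ : ∃ D, D = wedge v w := ⟨_, rfl⟩
    rw [← hD] at h ⊢
    ext i
    fin_cases i <;> simp [wedge] <;> field_simp <;> rw [hD, wedge] <;> ring
  continuous_toFun := by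
    unfold wedge
    fun_prop
  continuous_invFun := by fun_prop

theorem exists_interior_param {a b p : Plane} (hp : p ∈ segment ℝ a b) (ha : p ≠ a)
    (hb : p ≠ b) : ∃ s : ℝ, 0 < s ∧ s < 1 ∧ p = a + s • (b - a) := by
  rw [segment_eq_image'] at hp
  obtain ⟨s, ⟨h0, h1⟩, rfl⟩ := hp
  refine ⟨s, h0.lt_of_ne ?_, h1.lt_of_ne ?_, rfl⟩
  · rintro rfl; simp at ha
  · rintro rfl; simp at hb

theorem frame_symm_apply {p v w : Plane} (h : wedge v w ≠ 0) (y : Plane) :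
    (frame p v w h).symm y = p + y 0 • v + y 1 • w := rfl

/-- Segments in different directions cross at each common interior point. -/
theorem crossAt_segment {a b c d p : Plane} (hab : p ∈ segment ℝ a b) (hcd : p ∈ segment ℝ c d)
    (ha : p ≠ a) (hb : p ≠ b) (hc : p ≠ c) (hd : p ≠ d) (h : wedge (b - a) (d - c) ≠ 0) :
    CrossAt (segment ℝ a b) (segment ℝ c d) p := by
  obtain ⟨s, hs0, hs1, hs⟩ := exists_interior_param hab ha hb
  obtain ⟨t, ht0, ht1, ht⟩ := exists_interior_param hcd hc hd
  let φ := frame p (b - a) (d - c) h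
  -- The neighbourhood is kept so small that a point of it on either line has parameter strictly
  -- between 0 and 1, hence lies on the segment.
  have hU : IsOpen {x | -s < φ x 0 ∧ φ x 0 < 1 - s ∧ -t < φ x 1 ∧ φ x 1 < 1 - t} := by
    have := φ.continuous
    have h0 : Continuous fun x ↦ φ x 0 := by fun_prop
    have h1 : Continuous fun x ↦ φ x 1 := by fun_prop
    exact (isOpen_lt continuous_const h0).inter ((isOpen_lt h0 continuous_const).inter
      ((isOpen_lt continuous_const h1).inter (isOpen_lt h1 continuous_const)))
  have hφp : φ p = 0 := by
    ext i
    fin_cases i <;> simp [φ, frame, wedge]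
  refine ⟨φ.toOpenPartialHomeomorph.restrOpen _ hU, ?_, hφp, ?_⟩
  · simp [hφp, hs0, hs1, ht0, ht1]
  · intro x hx
    obtain ⟨-, hx1, hx2, hx3, hx4⟩ := hx
    change (_ ↔ φ x 1 = 0) ∧ (_ ↔ φ x 0 = 0)
    have hxφ : x = p + φ x 0 • (b - a) + φ x 1 • (d - c) :=
      (φ.symm_apply_apply x).symm.trans (frame_symm_apply h _)
    have uniq : ∀ m n : ℝ, x = p + m • (b - a) + n • (d - c) → φ x 0 = m ∧ φ x 1 = n := by
      intro m n hmn
      have : x = φ.symm !₂[m, n] := by simpa [φ, frame_symm_apply] using hmn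
      rw [this, φ.apply_symm_apply]
      simp
    constructor
    · rw [segment_eq_image']
      constructor
      · rintro ⟨τ, -, hτ⟩
        refine (uniq (τ - s) 0 ?_).2
        rw [← hτ, hs]
        module
      · intro h0
        refine ⟨s + φ x 0, ⟨by linarith, by linarith⟩, ?_⟩
        beta_reduce
        nth_rw 2 [hxφ]
        rw [h0, hs]
        module
    · rw [segment_eq_image']
      constructor
      · rintro ⟨τ, -, hτ⟩
        refine (uniq 0 (τ - t) ?_).1
        rw [← hτ, ht]
        module
      · intro h0
        refine ⟨t + φ x 1, ⟨by linarith, by linarith⟩, ?_⟩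
        beta_reduce
        nth_rw 2 [hxφ]
        rw [h0, ht]
        module

/-- The orientation of a triangle: twice its signed area. -/
def turn (p q r : Plane) : ℝ := wedge (q - p) (r - p)

theorem turn_segment {a b c d x : Plane} (hx : x ∈ segment ℝ c d) :
    ∃ t ∈ Set.Icc (0 : ℝ) 1, turn a b x = (1 - t) * turn a b c + t * turn a b d := by
  rw [segment_eq_image'] at hx
  obtain ⟨t, ht, rfl⟩ := hx
  refine ⟨t, ht, ?_⟩
  simp [turn, wedge]
  ring

theorem turn_self_left (a b : Plane) : turn a b a = 0 := by simp [turn, wedge]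

theorem turn_self_right (a b : Plane) : turn a b b = 0 := by
  simp [turn, wedge]
  ring

theorem turn_eq_zero_of_mem_segment {a b x : Plane} (hx : x ∈ segment ℝ a b) :
    turn a b x = 0 := by
  obtain ⟨t, -, h⟩ := turn_segment (a := a) (b := b) hx
  rw [h, turn_self_left, turn_self_right]
  ring

/-- Lines in different directions meet in at most one point. -/
theorem eq_of_turn_eq_zero {a b c d x y : Plane} (h : wedge (b - a) (d - c) ≠ 0)
    (hx : turn a b x = 0) (hx' : turn c d x = 0) (hy : turn a b y = 0) (hy' : turn c d y = 0) :
    x = y := by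
  simp only [turn, wedge, PiLp.sub_apply] at *
  -- Cramer's rule for the homogeneous system satisfied by `x - y`.
  have h0 : ((b 0 - a 0) * (d 1 - c 1) - (b 1 - a 1) * (d 0 - c 0)) * (x 0 - y 0) = 0 := by
    linear_combination (d 0 - c 0) * hx - (d 0 - c 0) * hy - (b 0 - a 0) * hx' + (b 0 - a 0) * hy'
  have h1 : ((b 0 - a 0) * (d 1 - c 1) - (b 1 - a 1) * (d 0 - c 0)) * (x 1 - y 1) = 0 := by
    linear_combination (d 1 - c 1) * hx - (d 1 - c 1) * hy - (b 1 - a 1) * hx' + (b 1 - a 1) * hy'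
  ext i
  fin_cases i
  · exact sub_eq_zero.1 ((mul_eq_zero.1 h0).resolve_left h)
  · exact sub_eq_zero.1 ((mul_eq_zero.1 h1).resolve_left h)

/-- If the end points of a segment are not on one line with another segment, but the segments
meet, then their directions are different. -/
theorem wedge_ne_zero_of_mem {a b c d p : Plane} (hab : p ∈ segment ℝ a b)
    (hcd : p ∈ segment ℝ c d) (h : turn a b c ≠ 0 ∨ turn a b d ≠ 0) :
    wedge (b - a) (d - c) ≠ 0 := by
  intro hw
  obtain ⟨t, -, ht⟩ := turn_segment (a := a) (b := b) hcd
  rw [turn_eq_zero_of_mem_segment hab] at ht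
  have hd : turn a b d = turn a b c + wedge (b - a) (d - c) := by
    simp [turn, wedge]
    ring
  rw [hw, add_zero] at hd
  have hc : turn a b c = 0 := by rw [hd] at ht; linarith
  rcases h with h | h
  exacts [h hc, h (hd.trans hc)]

/-! ### Straight-line drawings in general position -/

/-- No three points of the family are on one line. -/
def GeneralPosition {V : Type*} (P : V → Plane) : Prop :=
  Function.Injective P ∧
    ∀ u v w, u ≠ v → u ≠ w → v ≠ w → turn (P u) (P v) (P w) ≠ 0

section

variable {V : Type*} {K : SimpleGraph V} {P : V → Plane}

/-- Distinct edges share at most one end, so some end of `xy` is off the line through `P u` and `P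
v`. -/
theorem GeneralPosition.wedge_ne_zero (hP : GeneralPosition P) {u v x y : V} {p : Plane}
    (huv : u ≠ v) (hxy : x ≠ y) (hne : s(u, v) ≠ s(x, y)) (hp : p ∈ segment ℝ (P u) (P v))
    (hp' : p ∈ segment ℝ (P x) (P y)) : wedge (P v - P u) (P y - P x) ≠ 0 := by
  refine wedge_ne_zero_of_mem hp hp' ?_
  by_cases hx : u = x ∨ v = x
  · refine .inr (hP.2 _ _ _ huv ?_ ?_) <;> rintro rfl <;> simp [Sym2.eq_swap] at * <;> tauto
  · push Not at hx
    exact .inl (hP.2 _ _ _ huv hx.1 hx.2)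

/-- The segment that represents an edge. -/
def segmentArc (P : V → Plane) : Sym2 V → Set Plane :=
  Sym2.lift ⟨fun u v ↦ segment ℝ (P u) (P v), fun _ _ ↦ segment_symm ℝ _ _⟩

theorem segmentArc_mk (u v : V) : segmentArc P s(u, v) = segment ℝ (P u) (P v) := rfl

/-- The straight-line drawing of a graph on points in general position. -/
def straightDrawing (K : SimpleGraph V) (hP : GeneralPosition P) : Drawing K where
  point := P
  arc e := segmentArc P e
  point_injective := hP.1
  arc_isSimpleArc u v h := ⟨Path.segment _ _, fun s t hst ↦ by
    have hne : P u ≠ P v := hP.1.ne h.ne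
    exact Subtype.ext (AffineMap.lineMap_injective ℝ hne hst), by simp [segmentArc_mk]⟩
  mem_of_point_mem_arc := by
    rintro w ⟨⟨u, v⟩, h⟩ hw
    by_contra hne
    have hne : ¬ w ∈ s(u, v) := hne
    rw [Sym2.mem_iff, not_or] at hne
    exact hP.2 u v w (K.ne_of_adj h) (Ne.symm hne.1) (Ne.symm hne.2)
      (turn_eq_zero_of_mem_segment hw)
  crossAt := by
    rintro ⟨⟨u, v⟩, h⟩ ⟨⟨x, y⟩, h'⟩ p hne hp hp' hv
    have hv : ∀ w, p ≠ P w := fun w hw ↦ hv ⟨w, hw.symm⟩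
    exact crossAt_segment hp hp' (hv _) (hv _) (hv _) (hv _) (hP.wedge_ne_zero
      (K.ne_of_adj h) (K.ne_of_adj h') (fun he ↦ hne (Subtype.ext he)) hp hp')

theorem straightDrawing_isCrossing_unique {hP : GeneralPosition P} {e f : K.edgeSet}
    {p q : Plane} (hp : (straightDrawing K hP).IsCrossing e f p) (hq₁ : q ∈ segmentArc P e)
    (hq₂ : q ∈ segmentArc P f) : p = q := by
  obtain ⟨⟨u, v⟩, h⟩ := e
  obtain ⟨⟨x, y⟩, h'⟩ := f
  obtain ⟨hne, hp₁, hp₂, -⟩ := hp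
  exact eq_of_turn_eq_zero (hP.wedge_ne_zero
    (K.ne_of_adj h) (K.ne_of_adj h') (fun he ↦ hne (Subtype.ext he)) hp₁ hp₂)
    (turn_eq_zero_of_mem_segment hp₁) (turn_eq_zero_of_mem_segment hp₂)
    (turn_eq_zero_of_mem_segment hq₁) (turn_eq_zero_of_mem_segment hq₂)

theorem mem_segmentArc {v : V} {e : Sym2 V} (hv : v ∈ e) : P v ∈ segmentArc P e := by
  obtain ⟨u, rfl⟩ := Sym2.mem_iff_exists.1 hv
  exact left_mem_segment ℝ _ _

theorem straightDrawing_adjacent_not_crossing {hP : GeneralPosition P} (e f : K.edgeSet) (v : V)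
    (p : Plane) (he : v ∈ (e : Sym2 V)) (hf : v ∈ (f : Sym2 V)) :
    ¬ (straightDrawing K hP).IsCrossing e f p := fun h ↦
  h.2.2.2 ⟨v, (straightDrawing_isCrossing_unique h (mem_segmentArc he) (mem_segmentArc hf)).symm⟩

/-- If `c` and `d` were strictly on one side of the line `ab`, so would be the whole segment. This
turns the search for crossings into a finite sign check. -/
theorem turn_mul_turn_nonpos {a b c d p : Plane} (hab : p ∈ segment ℝ a b)
    (hcd : p ∈ segment ℝ c d) : turn a b c * turn a b d ≤ 0 := by
  obtain ⟨t, ⟨ht0, ht1⟩, ht⟩ := turn_segment (a := a) (b := b) hcd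
  rw [turn_eq_zero_of_mem_segment hab] at ht
  by_contra! hpos
  rcases pos_and_pos_or_neg_and_neg_of_mul_pos hpos with ⟨h1, h2⟩ | ⟨h1, h2⟩
  · nlinarith [mul_nonneg ht0 h2.le, mul_nonneg (sub_nonneg.2 ht1) h1.le]
  · nlinarith [mul_nonneg ht0 (neg_pos.2 h2).le, mul_nonneg (sub_nonneg.2 ht1) (neg_pos.2 h1).le]

/-- The true neighbours of a crossing are the end vertices of the crossing edges. -/
theorem OnePlanarDrawing.mem_or_mem_of_mem_neighborSet {D : OnePlanarDrawing K} {e f : K.edgeSet}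
    {c : D.FalseVertex} (hc : D.IsCrossing e f c.1) {v : V}
    (hv : Sum.inl v ∈ D.associatedGraph.neighborSet (Sum.inr c)) :
    v ∈ (e : Sym2 V) ∨ v ∈ (f : Sym2 V) := by
  obtain ⟨e', f', hc', hv⟩ := hv
  by_cases he : e = e'
  · exact .inl (he ▸ hv)
  · have : D.IsCrossing e e' c.1 := ⟨he, hc.2.1, hc'.2.1, hc.2.2.2⟩
    rw [(D.crossed_at_most_once _ _ _ _ _ hc this).1]
    exact .inr hv

end

/-! ### The star with four leaves: tightness -/

/-- Integer coordinates for the vertices of the join of a star with four leaves and a graph on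
two vertices. -/
def starJoinCoord : Fin 5 ⊕ Fin 2 → ℤ × ℤ
  -- The centre is `inl 0`. Leaves 1 and 2 lie inside the triangle formed by the centre and the two
  -- vertices of `H`, leaves 3 and 4 below it; each pair of leaves causes one crossing.
  | Sum.inl i => ![(0, 30), (1, 5), (2, 12), (30, -29), (-30, -30)] i
  | Sum.inr i => ![(-10, 0), (10, 0)] i

/-- The orientation of a triangle of vertices of the star join. -/
def starJoinTurn (u v w : Fin 5 ⊕ Fin 2) : ℤ :=
  ((starJoinCoord v).1 - (starJoinCoord u).1) * ((starJoinCoord w).2 - (starJoinCoord u).2) -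
    ((starJoinCoord v).2 - (starJoinCoord u).2) * ((starJoinCoord w).1 - (starJoinCoord u).1)

/-- The position of the vertices of the star join in the plane. -/
noncomputable def starJoinPoint (u : Fin 5 ⊕ Fin 2) : Plane :=
  !₂[((starJoinCoord u).1 : ℝ), ((starJoinCoord u).2 : ℝ)]

theorem turn_starJoinPoint (u v w : Fin 5 ⊕ Fin 2) :
    turn (starJoinPoint u) (starJoinPoint v) (starJoinPoint w) = starJoinTurn u v w := by
  simp [turn, wedge, starJoinPoint, starJoinTurn]

theorem starJoinTurn_ne_zero : ∀ u v w, u ≠ v → u ≠ w → v ≠ w → starJoinTurn u v w ≠ 0 := by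
  decide +kernel

theorem generalPosition_starJoinPoint : GeneralPosition starJoinPoint := by
  constructor
  · intro u v h
    have h0 : ((starJoinCoord u).1 : ℝ) = (starJoinCoord v).1 := congrArg (fun p : Plane ↦ p 0) h
    have h1 : ((starJoinCoord u).2 : ℝ) = (starJoinCoord v).2 := congrArg (fun p : Plane ↦ p 1) h
    have key : ∀ u v, starJoinCoord u = starJoinCoord v → u = v := by decide
    exact key u v (Prod.ext (by exact_mod_cast h0) (by exact_mod_cast h1))
  · intro u v w huv huw hvw
    rw [turn_starJoinPoint]
    exact_mod_cast starJoinTurn_ne_zero u v w huv huw hvw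

/-- Not both of the vertices are leaves. -/
def IsStarJoinEdge : Fin 5 ⊕ Fin 2 → Fin 5 ⊕ Fin 2 → Prop
  | Sum.inl i, Sum.inl j => i = 0 ∨ j = 0
  | _, _ => True

instance : DecidableRel IsStarJoinEdge
  | Sum.inl i, Sum.inl j => inferInstanceAs (Decidable (i = 0 ∨ j = 0))
  | Sum.inl _, Sum.inr _ => .isTrue trivial
  | Sum.inr _, Sum.inl _ => .isTrue trivial
  | Sum.inr _, Sum.inr _ => .isTrue trivial

/-- The join of the star with four leaves and a graph on two vertices. -/
abbrev starJoin (H : SimpleGraph (Fin 2)) : SimpleGraph (Fin 5 ⊕ Fin 2) :=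
  join (SimpleGraph.starGraph 0) H

theorem isStarJoinEdge_of_adj {H : SimpleGraph (Fin 2)} :
    ∀ {u v}, (starJoin H).Adj u v → IsStarJoinEdge u v
  | Sum.inl i, Sum.inl j, h => by
    rw [join_adj_inl_inl, SimpleGraph.starGraph_adj] at h
    exact h.2
  | Sum.inl _, Sum.inr _, _ => trivial
  | Sum.inr _, Sum.inl _, _ => trivial
  | Sum.inr _, Sum.inr _, _ => trivial

/-- The pairs of edges of the star join that cross. -/
def starJoinCrossings : List (Sym2 (Fin 5 ⊕ Fin 2) × Sym2 (Fin 5 ⊕ Fin 2)) :=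
  [(s(.inl 0, .inl 1), s(.inl 2, .inr 0)), (s(.inl 2, .inr 0), s(.inl 0, .inl 1)),
    (s(.inl 3, .inr 0), s(.inl 4, .inr 1)), (s(.inl 4, .inr 1), s(.inl 3, .inr 0))]

set_option synthInstance.maxSize 1000 in
set_option synthInstance.maxHeartbeats 200000 in
-- The sign conditions are necessary for two segments to meet. The edge between the two `inr`
-- vertices is allowed, so the check covers every `H`.
theorem mem_starJoinCrossings : ∀ u v x y, IsStarJoinEdge u v → IsStarJoinEdge x y → u ≠ v →
    x ≠ y → u ≠ x → u ≠ y → v ≠ x → v ≠ y → starJoinTurn u v x * starJoinTurn u v y ≤ 0 →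
    starJoinTurn x y u * starJoinTurn x y v ≤ 0 →
    (s(u, v), s(x, y)) ∈ starJoinCrossings := by
  decide +kernel

theorem mem_starJoinCrossings_of_isCrossing {H : SimpleGraph (Fin 2)}
    {e f : (starJoin H).edgeSet} {p : Plane}
    (hp : (straightDrawing (starJoin H) generalPosition_starJoinPoint).IsCrossing e f p) :
    ((e : Sym2 (Fin 5 ⊕ Fin 2)), (f : Sym2 (Fin 5 ⊕ Fin 2))) ∈ starJoinCrossings := by
  have hdisj := fun v he hf ↦ straightDrawing_adjacent_not_crossing e f v p he hf hp
  obtain ⟨⟨u, v⟩, h⟩ := e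
  obtain ⟨⟨x, y⟩, h'⟩ := f
  obtain ⟨-, hp₁, hp₂, -⟩ := hp
  have t₁ := turn_mul_turn_nonpos hp₁ hp₂
  have t₂ := turn_mul_turn_nonpos hp₂ hp₁
  simp only [turn_starJoinPoint] at t₁ t₂
  refine mem_starJoinCrossings u v x y (isStarJoinEdge_of_adj h) (isStarJoinEdge_of_adj h')
    (SimpleGraph.ne_of_adj (starJoin H) h) (SimpleGraph.ne_of_adj (starJoin H) h') ?_ ?_ ?_ ?_
    (by exact_mod_cast t₁) (by exact_mod_cast t₂)
  · rintro rfl; exact hdisj u (Sym2.mem_mk_left _ _) (Sym2.mem_mk_left _ _)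
  · rintro rfl; exact hdisj u (Sym2.mem_mk_left _ _) (Sym2.mem_mk_right _ _)
  · rintro rfl; exact hdisj v (Sym2.mem_mk_right _ _) (Sym2.mem_mk_left _ _)
  · rintro rfl; exact hdisj v (Sym2.mem_mk_right _ _) (Sym2.mem_mk_right _ _)

theorem starJoinCrossings_unique : ∀ x ∈ starJoinCrossings, ∀ y ∈ starJoinCrossings,
    x.1 = y.1 → x.2 = y.2 := by
  decide +kernel

/-- Each crossing is listed in both orders, hence `swap`; the two actual crossings share only `inr
0`. -/
theorem starJoinCrossings_common : ∀ x ∈ starJoinCrossings, ∀ y ∈ starJoinCrossings,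
    x = y ∨ x = y.swap ∨ ∀ v, v ∈ x.1 ∨ v ∈ x.2 → v ∈ y.1 ∨ v ∈ y.2 → v = .inr 0 := by
  decide +kernel

/-- A 1-planar drawing of the star join with two crossings. -/
noncomputable def starJoinDrawing (H : SimpleGraph (Fin 2)) : OnePlanarDrawing (starJoin H) where
  __ := straightDrawing (starJoin H) generalPosition_starJoinPoint
  crossed_at_most_once e f f' p p' hp hp' := by
    have hf : f = f' := Subtype.ext (starJoinCrossings_unique _
      (mem_starJoinCrossings_of_isCrossing hp) _ (mem_starJoinCrossings_of_isCrossing hp') rfl)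
    subst hf
    exact ⟨rfl, straightDrawing_isCrossing_unique hp hp'.2.1 hp'.2.2.1⟩
  adjacent_not_crossing := straightDrawing_adjacent_not_crossing

theorem hasDrawing_starJoin (H : SimpleGraph (Fin 2)) :
    HasDrawingWithCommonNeighborsLE (starJoin H) 1 := by
  refine ⟨starJoinDrawing H, ?_⟩
  rintro ⟨p, e, f, hp⟩ ⟨q, e', f', hq⟩ hne
  have hpq : p ≠ q := fun h ↦ hne (Subtype.ext h)
  have key : ∀ v : Fin 5 ⊕ Fin 2, v ∈ e.1 ∨ v ∈ f.1 → v ∈ e'.1 ∨ v ∈ f'.1 → v = Sum.inr 0 := by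
    rcases starJoinCrossings_common _ (mem_starJoinCrossings_of_isCrossing hp) _
      (mem_starJoinCrossings_of_isCrossing hq) with h | h | h
    · obtain ⟨h₁, h₂⟩ := Prod.ext_iff.1 h
      obtain rfl : e = e' := Subtype.ext h₁
      obtain rfl : f = f' := Subtype.ext h₂
      exact absurd (straightDrawing_isCrossing_unique (hP := generalPosition_starJoinPoint)
        hp hq.2.1 hq.2.2.1) hpq
    · obtain ⟨h₁, h₂⟩ := Prod.ext_iff.1 h
      obtain rfl : e = f' := Subtype.ext h₁
      obtain rfl : f = e' := Subtype.ext h₂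
      exact absurd (straightDrawing_isCrossing_unique (hP := generalPosition_starJoinPoint)
        hp hq.2.2.1 hq.2.1) hpq
    · exact h
  refine Set.encard_le_one_iff.2 ?_
  have key' : ∀ z ∈ (starJoinDrawing H).associatedGraph.neighborSet (Sum.inr ⟨p, e, f, hp⟩) ∩
      (starJoinDrawing H).associatedGraph.neighborSet (Sum.inr ⟨q, e', f', hq⟩),
      z = Sum.inl (Sum.inr 0) := by
    rintro (v | c) ⟨hv, hv'⟩
    · rw [key v (OnePlanarDrawing.mem_or_mem_of_mem_neighborSet hp hv)
        (OnePlanarDrawing.mem_or_mem_of_mem_neighborSet hq hv')]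
    · exact hv.elim
  exact fun a b ha hb ↦ (key' a ha).trans (key' b hb).symm

theorem isOfClassC₁_starJoin (H : SimpleGraph (Fin 2)) : IsOfClassC₁ (starJoin H) :=
  ⟨not_isOfClassC₀_join (v := 0) H (by decide), hasDrawing_starJoin H⟩

end OnePlanar

theorem mainTheorem6 :
    (∀ {V : Type*} [Fintype V] (G : SimpleGraph V) [DecidableRel G.Adj],
      OnePlanar.IsOfClassC₁ (OnePlanar.join G OnePlanar.twoP₁) ∨
        OnePlanar.IsOfClassC₁ (OnePlanar.join G OnePlanar.P₂) →
      G.maxDegree ≤ 4) ∧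
    (∃ (n : ℕ) (G : SimpleGraph (Fin n)) (_ : DecidableRel G.Adj),
      OnePlanar.IsOfClassC₁ (OnePlanar.join G OnePlanar.twoP₁) ∧ G.maxDegree = 4) ∧
    (∃ (n : ℕ) (G : SimpleGraph (Fin n)) (_ : DecidableRel G.Adj),
      OnePlanar.IsOfClassC₁ (OnePlanar.join G OnePlanar.P₂) ∧ G.maxDegree = 4) := by
  refine ⟨fun G _ h ↦ ?_, ⟨5, SimpleGraph.starGraph 0, inferInstance,
    OnePlanar.isOfClassC₁_starJoin _, by decide⟩, ⟨5, SimpleGraph.starGraph 0, inferInstance,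
    OnePlanar.isOfClassC₁_starJoin _, by decide⟩⟩
  rcases h with h | h
  exacts [OnePlanar.maxDegree_le_four G _ h.2, OnePlanar.maxDegree_le_four G _ h.2]
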